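/- Let $Z$ be a real normed space with closed unit ball $Z_1$ and dual $Z^*$. Write $f\diamond g$ if $\|f+g\|=\|f-g\|=\|f\|+\|g\|$, and for $A\subseteq Z$ let $A^\diamond$ be the set of all $g\in Z$ with $f\diamond g$ for every $f\in A$. For $u\in Z^*$ put $F_u=\{f\in Z_1: u(f)=1\}$. A norm exposed face is a non-empty set of the form $F_u$ with $\|u\|=1$. A norm exposed face $F$ is symmetric if there is a linear isometry $S_F$ of $Z$ onto $Z$ with $S_F^2=I$ whose fixed point set is the direct sum of subspaces $\overline{\mathrm{sp}}\,F\oplus F^\diamond$; in that case $P_2(F)$ denotes the projection of $Z$ onto $\overline{\mathrm{sp}}\,F$ that vanishes on $F^\diamond$ and on the $(-1)$-eigenspace of $S_F$. The space $Z$ is strongly facially symmetric if every norm exposed face $F$ is symmetric and $S_F^*y=y$ for every norm exposed face $F$ and every $y\in Z^*$ with $\|y\|=1$ and $F\subseteq F_y$. It is neutral if for every symmetric face $F$ and every $f\in Z$, $\|P_2(F)f\|=\|f\|$ implies $P_2(F)f=f$. A geometric tripotent is a $u\in Z^*$ with $\|u\|=1$ and $u|_{F_u^\diamond}=0$ such that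 $F_u$ is a symmetric face and $S_{F_u}^*u=u$. It is maximal if $v=u$ for every geometric tripotent $v$ with $F_u\subseteq F_v$, and unitary if $Z_1=\mathrm{co}(F_u\cup F_{-u})$. Let $Z$ be a real neutral strongly facially symmetric space that has a unitary geometric tripotent. Then every maximal geometric tripotent of $Z$ is unitary. -/

import Mathlib

namespace FacSym

variable {Z : Type*} [NormedAddCommGroup Z] [NormedSpace ℝ Z]

/-- Orthogonality `f ◇ g` of two elements of a normed space. -/
def Orth (f g : Z) : Prop :=
  ‖f + g‖ = ‖f‖ + ‖g‖ ∧ ‖f - g‖ = ‖f‖ + ‖g‖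

/-- `A^◇`: the elements orthogonal to every element of `A`. -/
def orthCompl (A : Set Z) : Set Z :=
  {g | ∀ f ∈ A, Orth f g}

/-- `F_u`: the elements of the closed unit ball at which `u` takes the value `1`. -/
def face (u : StrongDual ℝ Z) : Set Z :=
  {f | ‖f‖ ≤ 1 ∧ u f = 1}

/-- `F` is a norm exposed face of the closed unit ball. -/
def IsNormExposedFace (F : Set Z) : Prop :=
  F.Nonempty ∧ ∃ u : StrongDual ℝ Z, ‖u‖ = 1 ∧ F = face u

/-- The closed linear span of `F`. -/
def closedSpan (F : Set Z) : Submodule ℝ Z :=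
  (Submodule.span ℝ F).topologicalClosure

/-- `S` is a symmetry associated with `F`: a linear isometry of `Z` onto `Z` with `S² = I` whose
fixed point set is the direct sum of the subspaces `closedSpan F` and `F^◇`. -/
def IsSymmetryOf (S : Z ≃ₗᵢ[ℝ] Z) (F : Set Z) : Prop :=
  (∀ z, S (S z) = z) ∧
    ∃ N : Submodule ℝ Z, (N : Set Z) = orthCompl F ∧ Disjoint (closedSpan F) N ∧
      ∀ z, S z = z ↔ z ∈ closedSpan F ⊔ N

/-- A symmetric face: a norm exposed face with an associated symmetry. -/
def IsSymmetricFace (F : Set Z) : Prop :=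
  IsNormExposedFace F ∧ ∃ S : Z ≃ₗᵢ[ℝ] Z, IsSymmetryOf S F

/-- `P` is the geometric Peirce projection `P₂(F)` belonging to the symmetry `S` of `F`: the
projection onto `closedSpan F` that vanishes on `F^◇` and on the `-1` eigenspace of `S`. -/
def IsPeirceTwo (P : Z →ₗ[ℝ] Z) (S : Z ≃ₗᵢ[ℝ] Z) (F : Set Z) : Prop :=
  (∀ z ∈ closedSpan F, P z = z) ∧ (∀ z ∈ orthCompl F, P z = 0) ∧ ∀ z, S z = -z → P z = 0

/-- The Peirce projection `P₂(F)` exists and is unique. -/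
theorem IsSymmetryOf.existsUnique_peirceTwo {S : Z ≃ₗᵢ[ℝ] Z} {F : Set Z}
    (h : IsSymmetryOf S F) : ∃! P : Z →ₗ[ℝ] Z, IsPeirceTwo P S F := by
  obtain ⟨hS, N, hN, hd, hfix⟩ := h
  let M : Submodule ℝ Z := LinearMap.ker ((S.toLinearEquiv : Z →ₗ[ℝ] Z) + LinearMap.id)
  have hM : ∀ z, z ∈ M ↔ S z = -z := by
    intro z
    simp [M, LinearMap.mem_ker, eq_neg_iff_add_eq_zero]
  have hmemN : ∀ z, z ∈ orthCompl F ↔ z ∈ N := by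
    intro z
    rw [← hN]
    rfl
  have hdec : ∀ z, ∃ a ∈ closedSpan F, ∃ b ∈ N, ∃ c ∈ M, z = a + (b + c) := by
    intro z
    have h1 : (2⁻¹ : ℝ) • (z + S z) ∈ closedSpan F ⊔ N := by
      rw [← hfix, map_smul, map_add, hS, add_comm]
    obtain ⟨a, ha, b, hb, hab⟩ := Submodule.mem_sup.1 h1
    refine ⟨a, ha, b, hb, (2⁻¹ : ℝ) • (z - S z), ?_, ?_⟩
    · rw [hM, map_smul, map_sub, hS, ← smul_neg, neg_sub]
    · rw [← add_assoc, hab]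
      module
  have hc : IsCompl (closedSpan F) (N ⊔ M) := by
    constructor
    · rw [Submodule.disjoint_def]
      intro z hz hz'
      obtain ⟨b, hb, c, hc, hbc⟩ := Submodule.mem_sup.1 hz'
      have e1 : S z = z := (hfix z).2 (Submodule.mem_sup_left hz)
      have e2 : S b = b := (hfix b).2 (Submodule.mem_sup_right hb)
      have e3 : S c = -c := (hM c).1 hc
      have e4 : S c = c := by
        have : c = z - b := by rw [← hbc]; abel
        rw [this, map_sub, e1, e2]
      have e5 : c = 0 := by
        have h2 : c + c = 0 := eq_neg_iff_add_eq_zero.1 (e4.symm.trans e3)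
        rw [← two_smul ℝ c] at h2
        exact (smul_eq_zero.1 h2).resolve_left two_ne_zero
      rw [e5, add_zero] at hbc
      exact (Submodule.disjoint_def.1 hd) z hz (hbc ▸ hb)
    · rw [codisjoint_iff, eq_top_iff]
      intro z _
      obtain ⟨a, ha, b, hb, c, hc, rfl⟩ := hdec z
      exact Submodule.add_mem_sup ha (Submodule.add_mem_sup hb hc)
  have hz0 : ∀ z ∈ N ⊔ M, (closedSpan F).subtype.comp
      (Submodule.projectionOnto _ _ hc) z = 0 := by
    intro z hz
    have := (Submodule.projectionOnto_apply_eq_zero_iff hc).2 hz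
    simp [this]
  refine ⟨(closedSpan F).subtype.comp (Submodule.projectionOnto _ _ hc), ⟨?_, ?_, ?_⟩, ?_⟩
  · intro z hz
    have := Submodule.projectionOnto_apply_left hc ⟨z, hz⟩
    simp only [LinearMap.comp_apply, this, Submodule.subtype_apply]
  · exact fun z hz => hz0 z (Submodule.mem_sup_left ((hmemN z).1 hz))
  · exact fun z hz => hz0 z (Submodule.mem_sup_right ((hM z).2 hz))
  · intro Q ⟨hQ1, hQ2, hQ3⟩
    ext z
    obtain ⟨a, ha, b, hb, c, hc', rfl⟩ := hdec z
    have := Submodule.projectionOnto_apply_left hc ⟨a, ha⟩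
    rw [map_add, map_add, map_add, hz0 _ (Submodule.add_mem_sup hb hc'), hQ1 a ha,
      hQ2 b ((hmemN b).2 hb), hQ3 c ((hM c).1 hc')]
    simp only [LinearMap.comp_apply, this, Submodule.subtype_apply, add_zero]

variable (Z) in
/-- Weakly facially symmetric: every norm exposed face of the unit ball is symmetric. -/
def IsWFS : Prop :=
  ∀ F : Set Z, IsNormExposedFace F → IsSymmetricFace F

variable (Z) in
/-- Strongly facially symmetric. -/
def IsSFS : Prop :=
  IsWFS Z ∧ ∀ F : Set Z, IsNormExposedFace F → ∀ S : Z ≃ₗᵢ[ℝ] Z, IsSymmetryOf S F →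
    ∀ y : StrongDual ℝ Z, ‖y‖ = 1 → F ⊆ face y → ∀ z, y (S z) = y z

variable (Z) in
/-- Neutral: every Peirce projection `P = P₂(F)` of a symmetric face fixes each `f` with
`‖P f‖ = ‖f‖`. -/
def IsNeutral : Prop :=
  ∀ F : Set Z, IsSymmetricFace F → ∀ S : Z ≃ₗᵢ[ℝ] Z, IsSymmetryOf S F →
    ∀ P : Z →ₗ[ℝ] Z, IsPeirceTwo P S F → ∀ f, ‖P f‖ = ‖f‖ → P f = f

/-- A projective unit: a functional of norm one that vanishes on `F_u^◇`. -/
def IsProjectiveUnit (u : StrongDual ℝ Z) : Prop :=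
  ‖u‖ = 1 ∧ ∀ f ∈ orthCompl (face u), u f = 0

/-- A geometric tripotent: a projective unit `u` such that `F_u` is a symmetric face and
`S* u = u` for a symmetry `S` associated with `F_u`. -/
def IsGeometricTripotent (u : StrongDual ℝ Z) : Prop :=
  IsProjectiveUnit u ∧ IsSymmetricFace (face u) ∧
    ∃ S : Z ≃ₗᵢ[ℝ] Z, IsSymmetryOf S (face u) ∧ ∀ z, u (S z) = u z

/-- A geometric tripotent that is maximal for the order `u ≤ v ↔ F_u ⊆ F_v` on geometric
tripotents. -/
def IsMaximalTripotent (u : StrongDual ℝ Z) : Prop :=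
  IsGeometricTripotent u ∧
    ∀ v : StrongDual ℝ Z, IsGeometricTripotent v → face u ⊆ face v → v = u

/-- A unitary geometric tripotent: the unit ball is the convex hull of `F_e ∪ F_{-e}`. -/
def IsUnitaryTripotent (e : StrongDual ℝ Z) : Prop :=
  IsGeometricTripotent e ∧
    convexHull ℝ (face e ∪ face (-e)) = Metric.closedBall (0 : Z) 1

end FacSym

namespace FacSym

section

variable {Z : Type*} [NormedAddCommGroup Z]

/-! By maximality it suffices to put `face u` inside the face of some unitary tripotent `v`. Let `e`
be unitary. Each `f` in `face u` is `s • x - t • y` with `x`, `y` in `face e`, and `u f = 1` forces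
`u x = 1` and `u y = -1` whenever the respective weight is positive. Put D = {d ∈ `face e` : `u d =
-1`}. Then `y` lies in D and `x` in D^◇, so `v` should be `e` with its sign flipped along D.

The flip `J = I - 2 P₂(D)` is isometric if Z is the orthogonal sum of the closed span of D and D^◇,
that is, if the symmetry of D is the identity. This is `symmetry_eq_id`, the heart of the proof and
the place where neutrality is used. Orthogonality of the two summands is
`IsWFS.orth_of_mem_closedSpan`. -/

lemma Orth.symm {f g : Z} (h : Orth f g) : Orth g f := by
  refine ⟨?_, ?_⟩
  · rw [add_comm, h.1, add_comm]
  · rw [norm_sub_rev, h.2, add_comm]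

lemma isClosed_orthCompl (A : Set Z) : IsClosed (orthCompl A) := by
  have : orthCompl A = ⋂ f ∈ A, {g | Orth f g} := by ext; simp [orthCompl]
  rw [this]
  refine isClosed_biInter fun f _ => ?_
  exact (isClosed_eq (by fun_prop) (by fun_prop)).inter (isClosed_eq (by fun_prop) (by fun_prop))

end

/-! ### Faces, supporting functionals and orthogonality. -/

section

variable {Z : Type*} [NormedAddCommGroup Z] [NormedSpace ℝ Z]

lemma apply_le_norm {w : StrongDual ℝ Z} (hw : ‖w‖ ≤ 1) (z : Z) : w z ≤ ‖z‖ :=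
  (le_abs_self _).trans ((w.le_of_opNorm_le hw z).trans_eq (one_mul _))

lemma neg_apply_le_norm {w : StrongDual ℝ Z} (hw : ‖w‖ ≤ 1) (z : Z) : -w z ≤ ‖z‖ :=
  (neg_le_abs _).trans ((w.le_of_opNorm_le hw z).trans_eq (one_mul _))

lemma norm_eq_one_of_mem_face {w : StrongDual ℝ Z} (hw : ‖w‖ ≤ 1) {f : Z} (hf : f ∈ face w) :
    ‖f‖ = 1 :=
  le_antisymm hf.1 (hf.2 ▸ apply_le_norm hw f)

lemma norm_eq_one_of_nonempty_face {w : StrongDual ℝ Z} (hw : ‖w‖ ≤ 1)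
    (h : (face w).Nonempty) : ‖w‖ = 1 := by
  obtain ⟨f, hf⟩ := h
  refine le_antisymm hw ?_
  have h1 := w.le_opNorm f
  rw [hf.2, norm_eq_one_of_mem_face hw hf] at h1
  simpa using h1

lemma convex_face (w : StrongDual ℝ Z) : Convex ℝ (face w) := by
  intro x hx y hy a b ha hb hab
  refine ⟨?_, ?_⟩
  · have h1 := norm_add_le (a • x) (b • y)
    rw [norm_smul, norm_smul, Real.norm_of_nonneg ha, Real.norm_of_nonneg hb] at h1
    nlinarith [hx.1, hy.1, mul_le_mul_of_nonneg_left hx.1 ha, mul_le_mul_of_nonneg_left hy.1 hb]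
  · simp [hx.2, hy.2, hab]

lemma neg_mem_face {w : StrongDual ℝ Z} {f : Z} : -f ∈ face w ↔ f ∈ face (-w) := by
  simp [face]

lemma Orth.smul {f g : Z} (h : Orth f g) (c : ℝ) : Orth (c • f) (c • g) := by
  refine ⟨?_, ?_⟩
  · rw [← smul_add, norm_smul, h.1, norm_smul, norm_smul, mul_add]
  · rw [← smul_sub, norm_smul, h.2, norm_smul, norm_smul, mul_add]

/-- `w₁` bounds `‖f + g‖` from below by 2, and `w₂` does the same for `‖f - g‖`. -/
lemma orth_of_functionals {w₁ w₂ : StrongDual ℝ Z} (h₁ : ‖w₁‖ ≤ 1) (h₂ : ‖w₂‖ ≤ 1) {f g : Z}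
    (hf : ‖f‖ ≤ 1) (hg : ‖g‖ ≤ 1) (hf₁ : w₁ f = 1) (hg₁ : w₁ g = 1) (hf₂ : w₂ f = 1)
    (hg₂ : w₂ g = -1) : Orth f g := by
  have e1 : ‖f‖ = 1 := le_antisymm hf (hf₁ ▸ apply_le_norm h₁ f)
  have e2 : ‖g‖ = 1 := le_antisymm hg (hg₁ ▸ apply_le_norm h₁ g)
  refine ⟨le_antisymm (norm_add_le _ _) ?_, le_antisymm (norm_sub_le _ _) ?_⟩
  · have := apply_le_norm h₁ (f + g)
    rw [map_add] at this
    linarith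
  · have := apply_le_norm h₂ (f - g)
    rw [map_sub] at this
    linarith

lemma subset_closedSpan (F : Set Z) : F ⊆ closedSpan F :=
  Submodule.subset_span.trans (Submodule.le_topologicalClosure _)

lemma closedSpan_le {F : Set Z} {N : Submodule ℝ Z} (hN : IsClosed (N : Set Z)) (h : F ⊆ N) :
    closedSpan F ≤ N :=
  Submodule.topologicalClosure_minimal _ (Submodule.span_le.2 h) hN

/-- A functional of norm at most one that takes the value `1` on a convex set `F` of unit vectors
and at a unit vector `b` with `‖f + b‖ = 2` for all `f ∈ F`. -/
lemma exists_functional_eq_one {F : Set Z} (hF : Convex ℝ F) (hne : F.Nonempty)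
    (h1 : ∀ f ∈ F, ‖f‖ ≤ 1) {b : Z} (hb : ‖b‖ ≤ 1) (h : ∀ f ∈ F, 2 ≤ ‖f + b‖) :
    ∃ w : StrongDual ℝ Z, ‖w‖ ≤ 1 ∧ (∀ f ∈ F, w f = 1) ∧ w b = 1 := by
  -- Separate the open ball of radius 2 from `F + b`. Rescaled to norm at most one, the separating
  -- functional has values at `f` and `b` that sum to at least 2, so both equal 1.
  have hdisj : Disjoint (Metric.ball (0 : Z) 2) ((fun x => x + b) '' F) := by
    rw [Set.disjoint_left]
    rintro _ hx ⟨f, hf, rfl⟩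
    rw [mem_ball_zero_iff] at hx
    exact absurd (h f hf) (not_le.2 hx)
  have hconv : Convex ℝ ((fun x => x + b) '' F) := by
    simpa [add_comm] using hF.translate b
  obtain ⟨φ, c, hφ1, hφ2⟩ := geometric_hahn_banach_open (convex_ball (0 : Z) 2)
    Metric.isOpen_ball hconv hdisj
  have hc : 0 < c := by simpa using hφ1 0 (by simp)
  have hball : ∀ z : Z, ‖z‖ ≤ 2 → φ z ≤ c := by
    intro z hz
    have : z ∈ closure (Metric.ball (0 : Z) 2) := by
      rw [closure_ball _ two_ne_zero]
      simpa using hz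
    exact closure_minimal (fun x hx => (hφ1 x hx).le)
      (isClosed_le φ.continuous continuous_const) this
  have hle : ∀ z : Z, φ z ≤ c / 2 * ‖z‖ := by
    intro z
    rcases eq_or_ne z 0 with rfl | hz
    · simp
    have hz' : 0 < ‖z‖ := norm_pos_iff.2 hz
    have := hball ((2 / ‖z‖) • z) (by
      rw [norm_smul, Real.norm_of_nonneg (by positivity)]
      exact (div_mul_cancel₀ _ hz'.ne').le)
    rw [map_smul, smul_eq_mul, div_mul_eq_mul_div, div_le_iff₀ hz'] at this
    linarith
  have hw : ‖(2 / c) • φ‖ ≤ 1 := by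
    refine ContinuousLinearMap.opNorm_le_bound _ zero_le_one fun z => ?_
    have e1 := hle z
    have e2 := hle (-z)
    rw [map_neg, norm_neg] at e2
    have e3 : |φ z| ≤ c / 2 * ‖z‖ := abs_le.2 ⟨by linarith, e1⟩
    rw [smul_apply, norm_smul, Real.norm_of_nonneg (by positivity),
      Real.norm_eq_abs]
    calc 2 / c * |φ z| ≤ 2 / c * (c / 2 * ‖z‖) := by gcongr
      _ = 1 * ‖z‖ := by field_simp
  have hsum : ∀ f ∈ F, 2 ≤ ((2 / c) • φ) f + ((2 / c) • φ) b := by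
    intro f hf
    have := hφ2 _ ⟨f, hf, rfl⟩
    rw [← map_add, smul_apply, smul_eq_mul, div_mul_eq_mul_div, le_div_iff₀ hc]
    linarith
  have hbw := (apply_le_norm hw b).trans hb
  refine ⟨_, hw, fun f hf => ?_, ?_⟩
  · have := (apply_le_norm hw f).trans (h1 f hf)
    linarith [hsum f hf]
  · obtain ⟨f, hf⟩ := hne
    have := (apply_le_norm hw f).trans (h1 f hf)
    linarith [hsum f hf]

/-- In a weakly facially symmetric space the closed span of a norm exposed face `F` is orthogonal
to `F^◇`. -/
lemma IsWFS.orth_of_mem_closedSpan (hZ : IsWFS Z) {F : Set Z} (hF : IsNormExposedFace F) {a b : Z}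
    (ha : a ∈ closedSpan F) (hb : b ∈ orthCompl F) : Orth a b := by
  rcases eq_or_ne b 0 with rfl | hb0
  · simp [Orth]
  have hbpos : 0 < ‖b‖ := norm_pos_iff.2 hb0
  obtain ⟨-, -, -, N, hN, -⟩ := hZ F hF
  obtain ⟨hne, y, hy, rfl⟩ := hF
  set b' := ‖b‖⁻¹ • b with hb'
  have hb'1 : ‖b'‖ = 1 := norm_smul_inv_norm (𝕜 := ℝ) hb0
  have hb'N : b' ∈ orthCompl (face y) := by
    rw [← hN] at hb ⊢
    exact N.smul_mem _ hb
  have hnorm : ∀ f ∈ face y, ‖f‖ = 1 := fun f hf => norm_eq_one_of_mem_face hy.le hf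
  obtain ⟨w₁, hw₁, hw₁F, hw₁b⟩ := exists_functional_eq_one (convex_face y) hne (fun f hf => hf.1)
    hb'1.le (fun f hf => by rw [(hb'N f hf).1, hnorm f hf, hb'1]; norm_num)
  obtain ⟨w₂, hw₂, hw₂F, hw₂b⟩ := exists_functional_eq_one (convex_face y) hne (fun f hf => hf.1)
    (b := -b') (by rw [norm_neg, hb'1])
    (fun f hf => by rw [← sub_eq_add_neg, (hb'N f hf).2, hnorm f hf, hb'1]; norm_num)
  rw [map_neg] at hw₂b
  -- The functionals `w₁` and `w₂` agree on the given face and are opposite at `b'`. Half their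
  -- difference exposes a face containing `b'`, all of whose points are orthogonal to `face y`. The
  -- complement of this new face is a closed subspace, so it contains the whole closed span of `face
  -- y`.
  set w : StrongDual ℝ Z := (2⁻¹ : ℝ) • (w₁ - w₂) with hwdef
  have hw : ‖w‖ ≤ 1 := by
    rw [hwdef, norm_smul, Real.norm_of_nonneg (by norm_num)]
    linarith [norm_sub_le w₁ w₂]
  have hbG : b' ∈ face w := by
    refine ⟨hb'1.le, ?_⟩
    simp only [hwdef, smul_apply, sub_apply, smul_eq_mul]
    linarith
  have hG : IsNormExposedFace (face w) :=
    ⟨⟨b', hbG⟩, w, norm_eq_one_of_nonempty_face hw ⟨b', hbG⟩, rfl⟩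
  obtain ⟨-, -, -, N', hN', -⟩ := hZ _ hG
  have hFG : face y ⊆ N' := by
    intro f hf
    rw [hN']
    intro g hg
    have h1 := hg.2
    simp only [hwdef, smul_apply, sub_apply,
      smul_eq_mul] at h1
    have h2 := (apply_le_norm hw₁ g).trans hg.1
    have h3 := (neg_apply_le_norm hw₂ g).trans hg.1
    refine (orth_of_functionals hw₁ hw₂ hf.1 hg.1 (hw₁F f hf) ?_ (hw₂F f hf) ?_).symm <;> linarith
  have hle : closedSpan (face y) ≤ N' := closedSpan_le (hN' ▸ isClosed_orthCompl _) hFG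
  have key : ‖b‖⁻¹ • a ∈ orthCompl (face w) := by
    rw [← hN']
    exact hle (Submodule.smul_mem _ _ ha)
  have := (key b' hbG).symm.smul ‖b‖
  rwa [hb', smul_inv_smul₀ hbpos.ne', smul_inv_smul₀ hbpos.ne'] at this

/-- Two symmetries with the same fixed points agree. -/
lemma eq_of_fixed_iff {S T : Z ≃ₗᵢ[ℝ] Z} (hS : ∀ z, S (S z) = z) (hT : ∀ z, T (T z) = z)
    (h : ∀ z, S z = z ↔ T z = z) (z : Z) : S z = T z := by
  have h1 : S (z + T z) = z + T z := by
    rw [h, map_add, hT, add_comm]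
  set d := S z - T z with hd
  have hSd : S d = d := by
    rw [map_add] at h1
    rw [hd, map_sub, hS, eq_sub_of_add_eq' h1]
    abel
  have hTd : T d = d := (h d).1 hSd
  have hST : S (T z) = z - d := by
    rw [map_add] at h1
    rw [eq_sub_of_add_eq' h1, hd]
    abel
  -- `S ∘ T` fixes `d` and sends `z` to `z - d`. Its iterates move `z` along a line while preserving
  -- the norm, which is possible only for `d = 0`.
  have hiter : ∀ n : ℕ, ‖z - (n : ℝ) • d‖ = ‖z‖ := by
    intro n
    induction n with
    | zero => simp
    | succ n ih =>
      have : S (T (z - (n : ℝ) • d)) = z - ((n + 1 : ℕ) : ℝ) • d := by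
        rw [map_sub, map_sub, map_smul, map_smul, hTd, hSd, hST]
        push_cast
        module
      rw [← this, S.norm_map, T.norm_map, ih]
  by_contra hne
  have hd0 : 0 < ‖d‖ := norm_pos_iff.2 (sub_ne_zero.2 hne)
  obtain ⟨n, hn⟩ := exists_nat_gt (2 * ‖z‖ / ‖d‖)
  rw [div_lt_iff₀ hd0] at hn
  have e1 := norm_sub_norm_le ((n : ℝ) • d) z
  rw [norm_sub_rev, hiter, norm_smul, Real.norm_of_nonneg (Nat.cast_nonneg n)] at e1
  linarith

end

/-! ### Peirce projections, symmetries and unitary tripotents. -/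

section

variable {Z : Type*} [NormedAddCommGroup Z] [NormedSpace ℝ Z]
  {S : Z ≃ₗᵢ[ℝ] Z} {F : Set Z} {P : Z →ₗ[ℝ] Z}

lemma IsPeirceTwo.decomposition (hP : IsPeirceTwo P S F) (hS : IsSymmetryOf S F) (z : Z) :
    P z ∈ closedSpan F ∧ (2⁻¹ : ℝ) • (z + S z) - P z ∈ orthCompl F := by
  obtain ⟨hS2, N, hN, -, hfix⟩ := hS
  have h1 : (2⁻¹ : ℝ) • (z + S z) ∈ closedSpan F ⊔ N := by
    rw [← hfix, map_smul, map_add, hS2, add_comm]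
  obtain ⟨a, ha, b, hb, hab⟩ := Submodule.mem_sup.1 h1
  have hb' : b ∈ orthCompl F := hN ▸ hb
  have h2 : P ((2⁻¹ : ℝ) • (z - S z)) = 0 := by
    refine hP.2.2 _ ?_
    rw [map_smul, map_sub, hS2, ← smul_neg, neg_sub]
  have h3 : P z = a := by
    have : z = a + b + (2⁻¹ : ℝ) • (z - S z) := by rw [hab]; module
    rw [this, map_add, map_add, h2, hP.1 a ha, hP.2.1 b hb', add_zero, add_zero]
  refine ⟨h3 ▸ ha, ?_⟩
  rw [h3, ← hab, add_sub_cancel_left]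
  exact hb'

lemma norm_half_add_le (S : Z ≃ₗᵢ[ℝ] Z) (z : Z) : ‖(2⁻¹ : ℝ) • (z + S z)‖ ≤ ‖z‖ := by
  have := norm_add_le z (S z)
  rw [S.norm_map] at this
  rw [norm_smul, Real.norm_of_nonneg (by norm_num)]
  linarith

/-- The average of `z` and `S z` is a sum of two orthogonal pieces and has norm at most `‖z‖`. -/
lemma IsPeirceTwo.norm_add_le (hP : IsPeirceTwo P S F) (hS : IsSymmetryOf S F) (hZ : IsWFS Z)
    (hF : IsNormExposedFace F) (z : Z) :
    ‖P z‖ + ‖(2⁻¹ : ℝ) • (z + S z) - P z‖ ≤ ‖z‖ := by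
  obtain ⟨h1, h2⟩ := hP.decomposition hS z
  rw [← (hZ.orth_of_mem_closedSpan hF h1 h2).1, add_sub_cancel]
  exact norm_half_add_le S z

lemma IsPeirceTwo.norm_le (hP : IsPeirceTwo P S F) (hS : IsSymmetryOf S F) (hZ : IsWFS Z)
    (hF : IsNormExposedFace F) (z : Z) : ‖P z‖ ≤ ‖z‖ := by
  linarith [hP.norm_add_le hS hZ hF z, norm_nonneg ((2⁻¹ : ℝ) • (z + S z) - P z)]

lemma map_mem_closedSpan {T : Z ≃ₗᵢ[ℝ] Z} (hTF : ∀ z ∈ F, T z ∈ F) {z : Z}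
    (hz : z ∈ closedSpan F) : T z ∈ closedSpan F := by
  have : closedSpan F ≤ (closedSpan F).comap (T.toLinearEquiv : Z →ₗ[ℝ] Z) :=
    closedSpan_le ((Submodule.isClosed_topologicalClosure _).preimage T.continuous)
      fun z hz => subset_closedSpan F (hTF z hz)
  exact this hz

lemma map_mem_orthCompl {T : Z ≃ₗᵢ[ℝ] Z} (hT : ∀ z, T (T z) = z) (hTF : ∀ z ∈ F, T z ∈ F) {z : Z}
    (hz : z ∈ orthCompl F) : T z ∈ orthCompl F := by
  intro f hf
  have h1 := hz (T f) (hTF f hf)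
  refine ⟨?_, ?_⟩
  · rw [← T.norm_map (f + T z), map_add, hT, h1.1, T.norm_map, T.norm_map]
  · rw [← T.norm_map (f - T z), map_sub, hT, h1.2, T.norm_map, T.norm_map]

/-- A symmetry of `F` commutes with every isometric involution that preserves `F`. -/
lemma IsSymmetryOf.comm {T : Z ≃ₗᵢ[ℝ] Z} (hS : IsSymmetryOf S F) (hT : ∀ z, T (T z) = z)
    (hTF : ∀ z ∈ F, T z ∈ F) (z : Z) : S (T z) = T (S z) := by
  obtain ⟨hS2, N, hN, -, hfix⟩ := hS
  have hN' : ∀ z ∈ N, T z ∈ N := by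
    intro z hz
    rw [← SetLike.mem_coe, hN] at hz ⊢
    exact map_mem_orthCompl hT hTF hz
  have hsup : ∀ z, S z = z → S (T z) = T z := by
    intro z hz
    rw [hfix] at hz ⊢
    obtain ⟨a, ha, b, hb, rfl⟩ := Submodule.mem_sup.1 hz
    rw [map_add]
    exact Submodule.add_mem_sup (map_mem_closedSpan hTF ha) (hN' b hb)
  -- The conjugate `T S T` is an involution with the same fixed points as `S`.
  have := eq_of_fixed_iff (S := S) (T := (T.trans S).trans T) hS2
    (by intro z; simp [hT, hS2]) (by
      intro z
      simp only [LinearIsometryEquiv.coe_trans, Function.comp_apply]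
      constructor
      · intro hz
        rw [hsup z hz, hT]
      · intro hz
        have h1 : S (T z) = T z := by rw [← hT (S (T z)), hz]
        simpa [hT] using hsup _ h1) z
  simp only [LinearIsometryEquiv.coe_trans, Function.comp_apply] at this
  rw [this, hT]

/-- Conjugating `P` by `T` gives another Peirce projection for the same `S` and `F`, so uniqueness
applies. -/
lemma IsPeirceTwo.comm {T : Z ≃ₗᵢ[ℝ] Z} (hP : IsPeirceTwo P S F) (hS : IsSymmetryOf S F)
    (hT : ∀ z, T (T z) = z) (hTF : ∀ z ∈ F, T z ∈ F) (z : Z) : P (T z) = T (P z) := by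
  have hu := hS.existsUnique_peirceTwo
  let Q : Z →ₗ[ℝ] Z := (T.toLinearEquiv : Z →ₗ[ℝ] Z) ∘ₗ P ∘ₗ (T.toLinearEquiv : Z →ₗ[ℝ] Z)
  have hQ : ∀ z, Q z = T (P (T z)) := fun _ => rfl
  have h : IsPeirceTwo Q S F := by
    refine ⟨fun z hz => ?_, fun z hz => ?_, fun z hz => ?_⟩
    · rw [hQ, hP.1 _ (map_mem_closedSpan hTF hz), hT]
    · rw [hQ, hP.2.1 _ (map_mem_orthCompl hT hTF hz), map_zero]
    · rw [hQ, hP.2.2 _ (by rw [hS.comm hT hTF, hz, map_neg]), map_zero]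
  have := hQ z
  rw [hu.unique h hP] at this
  rw [this, hT]

/-- A point of the unit ball of a space with a unitary tripotent is a convex combination of a point
of the face and a point of the opposite face. -/
lemma IsUnitaryTripotent.exists_combination {e : StrongDual ℝ Z} (he : IsUnitaryTripotent e) {f : Z}
    (hf : ‖f‖ ≤ 1) : ∃ x ∈ face e, ∃ y ∈ face e, ∃ s t : ℝ, 0 ≤ s ∧ 0 ≤ t ∧ s + t = 1 ∧
      f = s • x - t • y := by
  have hne : (face e).Nonempty := he.1.2.1.1.1
  have hne' : (face (-e)).Nonempty := by
    obtain ⟨f, hf⟩ := hne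
    exact ⟨-f, by rw [neg_mem_face, neg_neg]; exact hf⟩
  have h : f ∈ convexHull ℝ (face e ∪ face (-e)) := by
    rw [he.2]
    simpa using hf
  rw [convexHull_union hne hne', (convex_face e).convexHull_eq, (convex_face (-e)).convexHull_eq,
    mem_convexJoin] at h
  obtain ⟨x, hx, y, hy, s, t, hs, ht, hst, rfl⟩ := h
  refine ⟨x, hx, -y, ?_, s, t, hs, ht, hst, by rw [smul_neg, sub_neg_eq_add]⟩
  rwa [neg_mem_face]

lemma IsUnitaryTripotent.eq_top {e : StrongDual ℝ Z} (he : IsUnitaryTripotent e)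
    {M : Submodule ℝ Z} (h : face e ⊆ M) : M = ⊤ := by
  rw [eq_top_iff]
  intro z _
  rcases eq_or_ne z 0 with rfl | hz
  · exact M.zero_mem
  obtain ⟨x, hx, y, hy, s, t, -, -, -, hf⟩ := he.exists_combination (f := ‖z‖⁻¹ • z)
    (norm_smul_inv_norm (𝕜 := ℝ) hz).le
  rw [← smul_inv_smul₀ (norm_ne_zero_iff.2 hz) z, hf]
  exact M.smul_mem _ (M.sub_mem (M.smul_mem _ (h hx)) (M.smul_mem _ (h hy)))

/-- The symmetry of a norm exposed face below a unitary tripotent of a neutral strongly facially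
symmetric space is the identity. -/
theorem symmetry_eq_id (hZ : IsSFS Z) (hn : IsNeutral Z) {e : StrongDual ℝ Z}
    (he : IsUnitaryTripotent e) (hF : IsNormExposedFace F) (hFe : F ⊆ face e)
    (hS : IsSymmetryOf S F) (z : Z) : S z = z := by
  have he1 : ‖e‖ ≤ 1 := he.1.1.1.le
  have heS : ∀ z, e (S z) = e z := hZ.2 F hF S hS e he.1.1.1 hFe
  obtain ⟨P, hP, -⟩ := hS.existsUnique_peirceTwo
  have hadd := hP.norm_add_le hS hZ.1 hF
  have hPS : ∀ z, P (S z) = P z := by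
    intro z
    have := hP.2.2 (z - S z) (by rw [map_sub, hS.1, neg_sub])
    rw [map_sub, sub_eq_zero] at this
    exact this.symm
  let Pc : Z →L[ℝ] Z := P.mkContinuous 1 fun z => by
    rw [one_mul]; exact hP.norm_le hS hZ.1 hF z
  -- `e'` equals `e` on the closed span of `F`, `-e` on F^◇, and 0 on the (-1)-eigenspace of `S`,
  -- where `e` vanishes because `e ∘ S = e`. The plan is to show that `face e'` spans a dense
  -- subspace and is fixed pointwise by `S`.
  set e' : StrongDual ℝ Z := (2 : ℝ) • e.comp Pc - e with he'def
  have he' : ∀ z, e' z = 2 * e (P z) - e z := fun z => rfl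
  have hehalf : ∀ z, e z = e (P z) + e ((2⁻¹ : ℝ) • (z + S z) - P z) := by
    intro z
    rw [map_sub, map_smul, map_add, heS, smul_eq_mul]
    ring
  have he'1 : ‖e'‖ ≤ 1 := by
    refine ContinuousLinearMap.opNorm_le_bound _ zero_le_one fun z => ?_
    rw [one_mul, he', hehalf z, Real.norm_eq_abs, abs_le]
    have h1 := apply_le_norm he1 (P z)
    have h2 := neg_apply_le_norm he1 (P z)
    have h3 := apply_le_norm he1 ((2⁻¹ : ℝ) • (z + S z) - P z)
    have h4 := neg_apply_le_norm he1 ((2⁻¹ : ℝ) • (z + S z) - P z)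
    have h5 := hadd z
    constructor <;> linarith
  have hFe' : F ⊆ face e' := by
    intro f hf
    refine ⟨(hFe hf).1, ?_⟩
    rw [he', hP.1 f (subset_closedSpan F hf), (hFe hf).2]
    norm_num
  have hC : IsNormExposedFace (face e') := by
    have := hF.1.mono hFe'
    exact ⟨this, e', norm_eq_one_of_nonempty_face he'1 this, rfl⟩
  obtain ⟨-, T, hT⟩ := hZ.1 _ hC
  obtain ⟨Q, hQ, -⟩ := hT.existsUnique_peirceTwo
  have hQS : ∀ z, Q (S z) = S (Q z) := by
    refine hQ.comm hT hS.1 fun z hz => ⟨?_, ?_⟩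
    · rw [S.norm_map]; exact hz.1
    · rw [he', hPS, heS, ← he']; exact hz.2
  -- the face of `e` decomposes along `F`
  have hface : ∀ x ∈ face e, Q ((2⁻¹ : ℝ) • (x + S x)) = (2⁻¹ : ℝ) • (x + S x) := by
    intro x hx
    set b := (2⁻¹ : ℝ) • (x + S x) - P x with hbdef
    have hdec := hP.decomposition hS x
    have h1 := hehalf x
    rw [hx.2, ← hbdef] at h1
    have hb : b ∈ closedSpan (face e') := by
      rcases eq_or_ne b 0 with hb0 | hb0
      · rw [hb0]; exact Submodule.zero_mem _
      have hbpos : 0 < ‖b‖ := norm_pos_iff.2 hb0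
      have h2 : e b = ‖b‖ := by
        refine le_antisymm (apply_le_norm he1 b) ?_
        have h2 := hadd x
        rw [← hbdef] at h2
        linarith [apply_le_norm he1 (P x), hx.1]
      have h3 : -(‖b‖⁻¹ • b) ∈ face e' := by
        refine ⟨by rw [norm_neg]; exact (norm_smul_inv_norm (𝕜 := ℝ) hb0).le, ?_⟩
        rw [map_neg, map_smul, he', hP.2.1 b hdec.2, map_zero, h2, smul_eq_mul]
        field_simp
        norm_num
      have h4 := Submodule.smul_mem _ (-‖b‖) (subset_closedSpan _ h3)
      rwa [neg_smul, smul_neg, neg_neg, smul_inv_smul₀ hbpos.ne'] at h4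
    have ha : P x ∈ closedSpan (face e') :=
      closedSpan_le (Submodule.isClosed_topologicalClosure _)
        (hFe'.trans (subset_closedSpan _)) hdec.1
    refine hQ.1 _ ?_
    have := Submodule.add_mem _ ha hb
    rwa [hbdef, add_sub_cancel] at this
  -- The average of `x` and `S x` has norm at least 1 because `e` is 1 there. It is also the average
  -- of `Q x` and `S (Q x)`, so `‖Q x‖ ≥ 1` and neutrality gives `Q x = x`.
  have hQid : ∀ x ∈ face e, Q x = x := by
    intro x hx
    refine hn _ ⟨hC, T, hT⟩ T hT Q hQ x (le_antisymm (hQ.norm_le hT hZ.1 hC x) ?_)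
    have h1 := hface x hx
    rw [map_smul, map_add, hQS] at h1
    have h2 := norm_half_add_le S (Q x)
    rw [h1] at h2
    refine le_trans ?_ h2
    have h3 := apply_le_norm he1 ((2⁻¹ : ℝ) • (x + S x))
    rw [map_smul, map_add, heS, hx.2, smul_eq_mul] at h3
    linarith [hx.1]
  have hQrange : closedSpan (face e') = ⊤ := he.eq_top fun x hx => by
    rw [SetLike.mem_coe, ← hQid x hx]
    exact (hQ.decomposition hT x).1
  -- the face of `e'` is fixed by the symmetry
  let fix : Submodule ℝ Z :=
    LinearMap.ker ((S.toLinearEquiv : Z →ₗ[ℝ] Z) - LinearMap.id)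
  have hmem : ∀ z, z ∈ fix ↔ S z = z := by
    intro z
    simp [fix, LinearMap.mem_ker, sub_eq_zero]
  have hfixc : IsClosed (fix : Set Z) := by
    have : (fix : Set Z) = {z | S z = z} := by ext z; exact hmem z
    rw [this]
    exact isClosed_eq S.continuous continuous_id
  have horth : ∀ y ∈ face e, e' y = -1 → S y = y := by
    intro y hy hy'
    have : y ∈ orthCompl F := fun f hf =>
      orth_of_functionals he1 he'1 (hFe hf).1 hy.1 (hFe hf).2 hy.2 (hFe' hf).2 hy'
    obtain ⟨-, N, hN, -, hfix⟩ := hS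
    rw [hfix]
    rw [← hN] at this
    exact Submodule.mem_sup_right this
  have hspan : ∀ x ∈ face e, e' x = 1 → S x = x := by
    intro x hx hx'
    rw [he', hx.2] at hx'
    have : P x = x := by
      -- Here `e (P x) = 1`, so `P x` has norm at least 1 and neutrality applies.
      refine hn F ⟨hF, S, hS⟩ S hS P hP x (le_antisymm (hP.norm_le hS hZ.1 hF x) ?_)
      linarith [apply_le_norm he1 (P x), hx.1]
    have hxF := (hP.decomposition hS x).1
    rw [this] at hxF
    obtain ⟨-, N, hN, -, hfix⟩ := hS
    exact (hfix x).2 (Submodule.mem_sup_left hxF)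
  have hsub : face e' ⊆ fix := by
    intro f hf
    obtain ⟨x, hx, y, hy, s, t, hs, ht, hst, rfl⟩ := he.exists_combination hf.1
    -- A convex combination of `e' x` and `-e' y`, both at most 1, equals 1. Each one carrying
    -- positive weight is therefore 1.
    have h1 := hf.2
    rw [map_sub, map_smul, map_smul, smul_eq_mul, smul_eq_mul] at h1
    have h2 := (apply_le_norm he'1 x).trans hx.1
    have h3 := (neg_apply_le_norm he'1 y).trans hy.1
    refine fix.sub_mem ?_ ?_
    · rcases hs.eq_or_lt with rfl | hs
      · rw [zero_smul]; exact fix.zero_mem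
      · exact fix.smul_mem _ ((hmem x).2 (hspan x hx (by nlinarith)))
    · rcases ht.eq_or_lt with rfl | ht
      · rw [zero_smul]; exact fix.zero_mem
      · exact fix.smul_mem _ ((hmem y).2 (horth y hy (by nlinarith)))
  have htop : closedSpan (face e') ≤ fix := closedSpan_le hfixc hsub
  rw [hQrange] at htop
  exact (hmem z).1 (htop Submodule.mem_top)

/-- A functional whose face and opposite face have the unit ball as convex hull is a unitary
tripotent. -/
lemma isUnitaryTripotent_of_convexHull (hZ : IsSFS Z) {u : StrongDual ℝ Z} (hu : ‖u‖ = 1)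
    (hne : (face u).Nonempty)
    (h : convexHull ℝ (face u ∪ face (-u)) = Metric.closedBall (0 : Z) 1) :
    IsUnitaryTripotent u := by
  have hF : IsNormExposedFace (face u) := ⟨hne, u, hu, rfl⟩
  have hsym := hZ.1 _ hF
  obtain ⟨S, hS⟩ := hsym.2
  have hS' := hS
  obtain ⟨-, N, hN, hd, -⟩ := hS'
  refine ⟨⟨⟨hu, fun f hf => ?_⟩, hsym, S, hS, hZ.2 _ hF S hS u hu subset_rfl⟩, h⟩
  -- The face spans Z, so its orthogonal complement is zero and `u` vanishes there trivially.
  have hball : Metric.closedBall (0 : Z) 1 ⊆ closedSpan (face u) := by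
    rw [← h]
    refine convexHull_min (Set.union_subset (subset_closedSpan _) fun z hz => ?_)
      (Submodule.convex _)
    rw [← neg_mem_face] at hz
    simpa using subset_closedSpan _ hz
  have hf' : f ∈ closedSpan (face u) := by
    rcases eq_or_ne f 0 with rfl | hf0
    · exact Submodule.zero_mem _
    have h1 := hball (show ‖f‖⁻¹ • f ∈ _ by
      rw [mem_closedBall_zero_iff]; exact (norm_smul_inv_norm (𝕜 := ℝ) hf0).le)
    rw [← smul_inv_smul₀ (norm_ne_zero_iff.2 hf0) f]
    exact Submodule.smul_mem _ _ h1
  rw [← hN] at hf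
  rw [Submodule.disjoint_def.1 hd f hf' hf, map_zero]

/-- Composition with a linear isometric involution preserves unitary tripotents. -/
lemma IsUnitaryTripotent.comp (hZ : IsSFS Z) {e u : StrongDual ℝ Z} (he : IsUnitaryTripotent e)
    (J : Z →ₗ[ℝ] Z) (hJ : ∀ z, J (J z) = z) (hJn : ∀ z, ‖J z‖ = ‖z‖) (hu : ∀ z, u z = e (J z)) :
    IsUnitaryTripotent u := by
  have hu1 : ‖u‖ ≤ 1 := by
    refine ContinuousLinearMap.opNorm_le_bound _ zero_le_one fun z => ?_
    rw [hu, ← hJn z, ← he.1.1.1]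
    exact e.le_opNorm _
  have hface : ∀ z ∈ face e, J z ∈ face u := fun z hz =>
    ⟨by rw [hJn]; exact hz.1, by rw [hu, hJ]; exact hz.2⟩
  have hne : (face u).Nonempty := by
    obtain ⟨z, hz⟩ := he.1.2.1.1.1
    exact ⟨_, hface z hz⟩
  refine isUnitaryTripotent_of_convexHull hZ (norm_eq_one_of_nonempty_face hu1 hne) hne ?_
  refine Set.Subset.antisymm (convexHull_min ?_ (convex_closedBall _ _)) fun z hz => ?_
  · rintro z (hz | hz) <;> simpa using hz.1
  · rw [mem_closedBall_zero_iff, ← hJn] at hz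
    obtain ⟨x, hx, y, hy, s, t, hs, ht, hst, h⟩ := he.exists_combination hz
    have h1 : z = s • J x + t • -J y := by
      rw [← hJ z, h, map_sub, map_smul, map_smul, smul_neg, sub_eq_add_neg]
    rw [h1]
    refine convex_convexHull ℝ (face u ∪ face (-u)) (subset_convexHull ℝ _ (Or.inl (hface x hx)))
      (subset_convexHull ℝ _ (Or.inr ?_)) hs ht hst
    rw [← neg_mem_face, neg_neg]
    exact hface y hy

end

end FacSym

open FacSym in
/-- In a neutral strongly facially symmetric space with a unitary tripotent, the face of a
functional of norm at most one lies in the face of a unitary tripotent. -/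
theorem exists_unitary_ge {Z : Type*} [NormedAddCommGroup Z] [NormedSpace ℝ Z]
    (hZ : IsSFS Z) (hn : IsNeutral Z) {e : StrongDual ℝ Z} (he : IsUnitaryTripotent e)
    {u : StrongDual ℝ Z} (hu : ‖u‖ ≤ 1) :
    ∃ v : StrongDual ℝ Z, IsUnitaryTripotent v ∧ face u ⊆ face v := by
  have he1 : ‖e‖ ≤ 1 := he.1.1.1.le
  -- If D is empty no flip is needed, and `e` itself serves as `v`.
  by_cases hne : ∃ d ∈ face e, u d = -1
  swap
  · refine ⟨e, he, fun f hf => ?_⟩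
    obtain ⟨x, hx, y, hy, s, t, hs, ht, hst, rfl⟩ := he.exists_combination hf.1
    have h1 := hf.2
    rw [map_sub, map_smul, map_smul, smul_eq_mul, smul_eq_mul] at h1
    have h2 := (apply_le_norm hu x).trans hx.1
    have h3 := (neg_apply_le_norm hu y).trans hy.1
    have ht0 : t = 0 := by
      rcases ht.eq_or_lt with h | h
      · exact h.symm
      · exact absurd ⟨y, hy, by nlinarith⟩ hne
    have hs1 : s = 1 := by linarith
    simpa [ht0, hs1] using hx
  -- `face w` is exactly D, which shows that D is norm exposed.
  set w : StrongDual ℝ Z := (2⁻¹ : ℝ) • (e - u) with hwdef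
  have hwz : ∀ z, w z = 2⁻¹ * (e z - u z) := fun z => rfl
  have hw : ‖w‖ ≤ 1 := by
    rw [hwdef, norm_smul, Real.norm_of_nonneg (by norm_num)]
    linarith [norm_sub_le e u]
  have hDmem : ∀ d ∈ face e, u d = -1 → d ∈ face w := fun d hd hd' =>
    ⟨hd.1, by rw [hwz, hd.2, hd']; norm_num⟩
  have hD1 : ∀ d ∈ face w, d ∈ face e ∧ u d = -1 := by
    intro d hd
    have h1 := hd.2
    rw [hwz] at h1
    have h2 := (apply_le_norm he1 d).trans hd.1
    have h3 := (neg_apply_le_norm hu d).trans hd.1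
    exact ⟨⟨hd.1, by linarith⟩, by linarith⟩
  have hDne : (face w).Nonempty := by
    obtain ⟨d, hd, hd'⟩ := hne
    exact ⟨d, hDmem d hd hd'⟩
  have hD : IsNormExposedFace (face w) := ⟨hDne, w, norm_eq_one_of_nonempty_face hw hDne, rfl⟩
  obtain ⟨-, S, hS⟩ := hZ.1 _ hD
  obtain ⟨P, hP, -⟩ := hS.existsUnique_peirceTwo
  have hSid := symmetry_eq_id hZ hn he hD (fun d hd => (hD1 d hd).1) hS
  have hdec : ∀ z, P z ∈ closedSpan (face w) ∧ z - P z ∈ orthCompl (face w) := by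
    intro z
    have := hP.decomposition hS z
    rwa [hSid, ← two_smul ℝ z, inv_smul_smul₀ two_ne_zero] at this
  let J : Z →ₗ[ℝ] Z := LinearMap.id - (2 : ℝ) • P
  have hJ : ∀ z, J z = z - (2 : ℝ) • P z := fun z => rfl
  have hPP : ∀ z, P (P z) = P z := fun z => hP.1 _ (hdec z).1
  have hJn : ∀ z, ‖J z‖ = ‖z‖ := by
    intro z
    -- `J` changes the sign of one of two orthogonal summands, which leaves the norm unchanged.
    obtain ⟨h1, h2⟩ := hZ.1.orth_of_mem_closedSpan hD (hdec z).1 (hdec z).2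
    rw [add_sub_cancel] at h1
    rw [h1, ← h2, ← norm_neg, hJ]
    congr 1
    module
  have hJJ : ∀ z, J (J z) = z := by
    intro z
    rw [hJ (J z), hJ z, map_sub, map_smul, hPP]
    module
  let v : StrongDual ℝ Z := e.comp (J.mkContinuous 1 fun z => by rw [one_mul, hJn])
  have hv : ∀ z, v z = e (J z) := fun z => rfl
  refine ⟨v, he.comp hZ J hJJ hJn hv, fun f hf => ⟨hf.1, ?_⟩⟩
  obtain ⟨x, hx, y, hy, s, t, hs, ht, hst, rfl⟩ := he.exists_combination hf.1
  have h1 := hf.2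
  rw [map_sub, map_smul, map_smul, smul_eq_mul, smul_eq_mul] at h1
  have h2 := (apply_le_norm hu x).trans hx.1
  have h3 := (neg_apply_le_norm hu y).trans hy.1
  have hvx : s * v x = s := by
    rcases hs.eq_or_lt with rfl | hs
    · simp
    have hux : u x = 1 := by nlinarith
    -- On D and at `x` the functional `e` is 1, while `-u` is 1 on D and -1 at `x`.
    have : x ∈ orthCompl (face w) := fun d hd => by
      refine orth_of_functionals (w₂ := -u) he1 (by rwa [norm_neg]) hd.1 hx.1 (hD1 d hd).1.2 hx.2
        ?_ ?_
      · rw [neg_apply, (hD1 d hd).2, neg_neg]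
      · rw [neg_apply, hux]
    rw [hv, hJ, hP.2.1 x this, smul_zero, sub_zero, hx.2, mul_one]
  have hvy : t * v y = -t := by
    rcases ht.eq_or_lt with rfl | ht
    · simp
    have huy : u y = -1 := by nlinarith
    rw [hv, hJ, hP.1 y (subset_closedSpan _ (hDmem y hy huy)), map_sub, map_smul, hy.2,
      smul_eq_mul]
    ring
  rw [map_sub, map_smul, map_smul, smul_eq_mul, smul_eq_mul, hvx, hvy]
  linarith

theorem lemma5 {Z : Type*} [NormedAddCommGroup Z] [NormedSpace ℝ Z]
    (hsfs : FacSym.IsSFS Z) (hneutral : FacSym.IsNeutral Z)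
    (hunitary : ∃ e : StrongDual ℝ Z, FacSym.IsUnitaryTripotent e)
    (u : StrongDual ℝ Z) (hu : FacSym.IsMaximalTripotent u) :
    FacSym.IsUnitaryTripotent u := by
  obtain ⟨e, he⟩ := hunitary
  obtain ⟨v, hv, huv⟩ := exists_unitary_ge hsfs hneutral he hu.1.1.1.le
  exact hu.2 v hv.1 huv ▸ hv
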